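/- Let $r \ge 3$ be an integer. Then there exist a real constant $C > 0$ and an integer $N$, both depending only on $r$, such that for every integer $n \ge N$, every (finite, simple) graph $G$ on $n$ vertices which contains no copy of the complete graph $K_r$ as a subgraph satisfies $$ \chi(G) \le C \left( \frac{n}{\log n} \right)^{(r-2)/(r-1)}, $$ where $\chi(G)$ denotes the chromatic number of $G$ and $\log$ is the natural logarithm. -/

import Mathlib

/-! Colour classes are peeled off greedily as large independent sets
(`exists_coloring_of_large_indep`), so the task is to find such sets in every clique-free set of
polynomial size (`exists_large_indep`). These come from the Ramsey bound
`exists_card_le_pow_div_log_pow`, proved by induction on the clique size. If independent sets have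
size at most `t`, induction bounds the degrees, while Erdős–Szekeres bounds the codegrees by a
quantity smaller by more than a factor of order `√t`.

`card_mul_le_of_codegree_le` turns this gap into a logarithm. Draw `I` from the hard-core model at
fugacity `1 / (2 * D)`, with `D` the codegree bound. For each `v`, `Δ * P(v ∈ I) + E|I ∩ N(v)|` is
at least `K`: either many neighbours of `v` are available and some are likely chosen, or few are and
`v` itself is likely enough. Summed over `v`, each member of `I` counts at most `2 * Δ` times, so
`|S| * K ≤ 2 * Δ * t`, with `K` of order `log t`. -/

open Classical in
/-- The independent subsets of `X`. -/
noncomputable def SimpleGraph.indepSubsets {V : Type*} (G : SimpleGraph V) (X : Finset V) :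
    Finset (Finset V) :=
  X.powerset.filter fun J => G.IsIndepSet (J : Set V)

/-- The partition function of the hard-core model on `X` at fugacity `l`. -/
noncomputable def SimpleGraph.hardCore {V : Type*} (G : SimpleGraph V) (l : ℝ) (X : Finset V) :
    ℝ :=
  ∑ J ∈ G.indepSubsets X, l ^ J.card

namespace SimpleGraph

variable {V : Type*} {G : SimpleGraph V}

/-! ### Partition function and occupation probabilities -/

lemma mem_indepSubsets {X J : Finset V} :
    J ∈ G.indepSubsets X ↔ J ⊆ X ∧ G.IsIndepSet (J : Set V) := by
  simp [indepSubsets]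

lemma isIndepSet_coe_iff {J : Finset V} :
    G.IsIndepSet (J : Set V) ↔ ∀ a ∈ J, ∀ b ∈ J, ¬ G.Adj a b := by
  constructor
  · intro h a ha b hb hab
    exact h ha hb hab.ne hab
  · intro h a ha b hb _
    exact h a ha b hb

lemma empty_mem_indepSubsets (X : Finset V) : ∅ ∈ G.indepSubsets X := by
  simp [mem_indepSubsets]

lemma one_le_hardCore {l : ℝ} (hl : 0 ≤ l) (X : Finset V) : 1 ≤ G.hardCore l X := by
  have := Finset.single_le_sum (f := fun J : Finset V => l ^ J.card)
    (fun J _ => pow_nonneg hl _) (empty_mem_indepSubsets (G := G) X)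
  simpa [hardCore] using this

lemma hardCore_le {l : ℝ} (hl : 0 ≤ l) (X : Finset V) :
    G.hardCore l X ≤ Real.exp (l * X.card) := by
  have h1 : G.hardCore l X ≤ ∑ J ∈ X.powerset, l ^ J.card :=
    Finset.sum_le_sum_of_subset_of_nonneg (fun J hJ => by
      simpa using (mem_indepSubsets.1 hJ).1) (fun J _ _ => pow_nonneg hl _)
  have h2 : ∑ J ∈ X.powerset, l ^ J.card = (l + 1) ^ X.card := by
    have := Finset.sum_pow_mul_eq_add_pow l 1 X
    simpa using this
  rw [h2] at h1
  refine h1.trans ?_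
  rw [mul_comm, Real.exp_nat_mul]
  exact pow_le_pow_left₀ (by linarith) (Real.add_one_le_exp l) _

open Classical in
/-- Deleting `u` maps the independent sets through `u` onto those avoiding `u` and its
neighbours. -/
lemma sum_indepSubsets_mem {l : ℝ} {X : Finset V} {u : V} (hu : u ∈ X) :
    ∑ J ∈ G.indepSubsets X with u ∈ J, l ^ J.card =
      l * ∑ J ∈ G.indepSubsets X with u ∉ J ∧ ∀ z ∈ J, ¬ G.Adj u z, l ^ J.card := by
  rw [Finset.mul_sum]
  refine Finset.sum_bij' (fun J _ => J.erase u) (fun J _ => insert u J) ?_ ?_ ?_ ?_ ?_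
  · intro J hJ
    simp only [Finset.mem_filter, mem_indepSubsets, isIndepSet_coe_iff] at hJ ⊢
    obtain ⟨⟨h1, h2⟩, h3⟩ := hJ
    exact ⟨⟨(Finset.erase_subset _ _).trans h1, fun a ha b hb =>
      h2 a (Finset.mem_of_mem_erase ha) b (Finset.mem_of_mem_erase hb)⟩,
      Finset.notMem_erase _ _, fun z hz => h2 u h3 z (Finset.mem_of_mem_erase hz)⟩
  · intro J hJ
    simp only [Finset.mem_filter, mem_indepSubsets, isIndepSet_coe_iff] at hJ ⊢
    obtain ⟨⟨h1, h2⟩, h3, h4⟩ := hJ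
    refine ⟨⟨Finset.insert_subset hu h1, ?_⟩, Finset.mem_insert_self _ _⟩
    intro a ha b hb hab
    rcases Finset.mem_insert.1 ha with rfl | ha' <;> rcases Finset.mem_insert.1 hb with rfl | hb'
    · exact hab.ne rfl
    · exact h4 b hb' hab
    · exact h4 a ha' hab.symm
    · exact h2 a ha' b hb' hab
  · intro J hJ
    exact Finset.insert_erase (Finset.mem_filter.1 hJ).2
  · intro J hJ
    exact Finset.erase_insert (Finset.mem_filter.1 hJ).2.1
  · intro J hJ
    have h := Finset.card_erase_add_one (Finset.mem_filter.1 hJ).2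
    rw [← h, pow_succ, mul_comm]

open Classical in
lemma sum_indepSubsets_mem_le {l : ℝ} (hl : 0 ≤ l) {X : Finset V} {u : V} (hu : u ∈ X) :
    ∑ J ∈ G.indepSubsets X with u ∈ J, l ^ J.card ≤ l * G.hardCore l X := by
  rw [sum_indepSubsets_mem hu]
  exact mul_le_mul_of_nonneg_left (Finset.sum_le_sum_of_subset_of_nonneg
    (Finset.filter_subset _ _) (fun J _ _ => pow_nonneg hl _)) hl

open Classical in
/-- In a set of small maximum degree, each vertex is occupied with probability at least `l / 4`. -/
lemma le_sum_indepSubsets_mem {l D : ℝ} (hl : 0 ≤ l) (hl1 : l ≤ 1) (hD : l * D ≤ 1 / 2)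
    {X : Finset V} {u : V} (hu : u ∈ X) (hdeg : ((X.filter (G.Adj u)).card : ℝ) ≤ D) :
    l / 4 * G.hardCore l X ≤ ∑ J ∈ G.indepSubsets X with u ∈ J, l ^ J.card := by
  set A := ∑ J ∈ G.indepSubsets X with u ∈ J, l ^ J.card with hA
  set B := ∑ J ∈ G.indepSubsets X with u ∉ J ∧ ∀ z ∈ J, ¬ G.Adj u z, l ^ J.card with hB
  have hAB : A = l * B := sum_indepSubsets_mem hu
  have hZ0 : 0 ≤ G.hardCore l X := zero_le_one.trans (one_le_hardCore hl X)
  -- Union bound: with probability at most `l * D ≤ 1 / 2` some neighbour of `u` is occupied.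
  have hR : ∑ z ∈ X.filter (G.Adj u), ∑ J ∈ G.indepSubsets X with z ∈ J, l ^ J.card ≤
      1 / 2 * G.hardCore l X := by
    calc _ ≤ ∑ z ∈ X.filter (G.Adj u), l * G.hardCore l X :=
          Finset.sum_le_sum fun z hz => sum_indepSubsets_mem_le hl (Finset.mem_filter.1 hz).1
      _ = (X.filter (G.Adj u)).card * (l * G.hardCore l X) := by simp
      _ ≤ D * (l * G.hardCore l X) :=
          mul_le_mul_of_nonneg_right hdeg (mul_nonneg hl hZ0)
      _ = l * D * G.hardCore l X := by ring
      _ ≤ _ := mul_le_mul_of_nonneg_right hD hZ0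
  have hsplit : G.hardCore l X ≤ A + B +
      ∑ z ∈ X.filter (G.Adj u), ∑ J ∈ G.indepSubsets X with z ∈ J, l ^ J.card := by
    simp only [hA, hB, hardCore, Finset.sum_filter (s := G.indepSubsets X)]
    rw [Finset.sum_comm (s := X.filter (G.Adj u)), ← Finset.sum_add_distrib,
      ← Finset.sum_add_distrib]
    refine Finset.sum_le_sum fun J hJ => ?_
    have hp : 0 ≤ l ^ J.card := pow_nonneg hl _
    have hs : 0 ≤ ∑ z ∈ X.filter (G.Adj u), (if z ∈ J then l ^ J.card else 0) :=
      Finset.sum_nonneg fun z _ => by split_ifs <;> simp [hp]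
    by_cases h1 : u ∈ J
    · simp only [h1, if_true, not_true, false_and, if_false]
      linarith
    · by_cases h2 : ∀ z ∈ J, ¬ G.Adj u z
      · rw [if_neg h1, if_pos ⟨h1, h2⟩]
        linarith
      · rw [if_neg h1, if_neg (fun h => h2 h.2)]
        push Not at h2
        obtain ⟨z, hz, huz⟩ := h2
        have hzX : z ∈ X.filter (G.Adj u) :=
          Finset.mem_filter.2 ⟨(mem_indepSubsets.1 hJ).1 hz, huz⟩
        have := Finset.single_le_sum (f := fun z => if z ∈ J then l ^ J.card else 0)
          (fun z _ => by split_ifs <;> simp [hp]) hzX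
        simp only [hz, if_true] at this
        linarith
  have h1 : 1 / 2 * G.hardCore l X ≤ A + B := by linarith
  have hB0 : 0 ≤ B := Finset.sum_nonneg fun J _ => pow_nonneg hl _
  have h2 : 1 / 2 * G.hardCore l X ≤ 2 * B := by
    have : l * B ≤ 1 * B := mul_le_mul_of_nonneg_right hl1 hB0
    linarith
  calc l / 4 * G.hardCore l X = l * (1 / 2 * G.hardCore l X) / 2 := by ring
    _ ≤ l * (2 * B) / 2 := by gcongr
    _ = A := by rw [hAB]; ring

open Classical in
/-- A lower bound for the expected size of a hard-core random set. -/
lemma le_sum_indepSubsets_card {l D : ℝ} (hl : 0 ≤ l) (hl1 : l ≤ 1) (hD : l * D ≤ 1 / 2)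
    {X : Finset V} (hdeg : ∀ u ∈ X, ((X.filter (G.Adj u)).card : ℝ) ≤ D) :
    l * X.card / 4 * G.hardCore l X ≤ ∑ J ∈ G.indepSubsets X, l ^ J.card * J.card := by
  have h : ∑ J ∈ G.indepSubsets X, l ^ J.card * J.card =
      ∑ u ∈ X, ∑ J ∈ G.indepSubsets X with u ∈ J, l ^ J.card := by
    simp only [Finset.sum_filter]
    rw [Finset.sum_comm]
    refine Finset.sum_congr rfl fun J hJ => ?_
    rw [← Finset.sum_filter, Finset.filter_mem_eq_inter,
      Finset.inter_eq_right.2 (mem_indepSubsets.1 hJ).1]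
    simp [mul_comm]
  rw [h]
  calc l * X.card / 4 * G.hardCore l X = ∑ u ∈ X, l / 4 * G.hardCore l X := by
        simp; ring
    _ ≤ _ := Finset.sum_le_sum fun u hu => le_sum_indepSubsets_mem hl hl1 hD hu (hdeg u hu)

/-! ### Local occupancy and the logarithmic gain -/

open Classical in
/-- The hard-core model inside the closed neighbourhood of a vertex, given its restriction to the
rest of the graph. -/
lemma local_occupancy {l D Δ K : ℝ} (hl : 0 ≤ l) (hl1 : l ≤ 1) (hD : l * D ≤ 1 / 2)
    (hK : 0 ≤ K) (hΔ : Real.exp (10 * K) ≤ Δ * l)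
    {X : Finset V} (hdeg : ∀ u ∈ X, ((X.filter (G.Adj u)).card : ℝ) ≤ D) :
    K * (l + G.hardCore l X) ≤ l * Δ + ∑ J ∈ G.indepSubsets X, l ^ J.card * J.card := by
  have hZ := one_le_hardCore (G := G) hl X
  have hsum := le_sum_indepSubsets_card hl hl1 hD hdeg
  have h2Z : K * (l + G.hardCore l X) ≤ K * (2 * G.hardCore l X) := by gcongr; linarith
  have hpos : 0 ≤ l * X.card / 4 * G.hardCore l X := by positivity
  refine h2Z.trans ?_
  -- If `l * |X|` is at least `8 * K`, the expected size of `J` is at least `2 * K`. Otherwise the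
  -- partition function is at most `exp (8 * K)`, and the term `l * Δ` alone suffices.
  rcases le_total (8 * K) (l * X.card) with h | h
  · have h1 : 2 * K * G.hardCore l X ≤ l * X.card / 4 * G.hardCore l X := by
      gcongr; linarith
    have h0 : 0 ≤ Δ * l := (Real.exp_pos _).le.trans hΔ
    linarith
  · have h1 : G.hardCore l X ≤ Real.exp (8 * K) :=
      (hardCore_le hl X).trans (Real.exp_le_exp.2 h)
    have h2 : 2 * K ≤ Real.exp (2 * K) := by
      have := Real.add_one_le_exp (2 * K); linarith
    have h3 : 2 * K * G.hardCore l X ≤ Real.exp (2 * K) * Real.exp (8 * K) := by gcongr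
    rw [← Real.exp_add, show 2 * K + 8 * K = 10 * K by ring] at h3
    linarith

open Classical in
/-- The independent sets of `S` with a given trace `T` outside the closed neighbourhood of `v`. -/
lemma indepSubsets_fiber {S T : Finset V} {v : V} (hv : v ∈ S) (hTS : T ⊆ S)
    (hTi : G.IsIndepSet (T : Set V)) (hTv : Disjoint T (insert v (S.filter (G.Adj v)))) :
    (G.indepSubsets S).filter (fun I => I \ insert v (S.filter (G.Adj v)) = T) =
      insert (insert v T) ((G.indepSubsets ((S.filter (G.Adj v)).filter
        fun u => ∀ z ∈ T, ¬ G.Adj u z)).image (T ∪ ·)) := by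
  rw [isIndepSet_coe_iff] at hTi
  have hTv' : ∀ z ∈ T, z ≠ v ∧ ¬ G.Adj v z := by
    intro z hz
    have := Finset.disjoint_left.1 hTv hz
    simp only [Finset.mem_insert, Finset.mem_filter, not_or, not_and] at this
    exact ⟨this.1, this.2 (hTS hz)⟩
  ext I
  simp only [Finset.mem_filter, Finset.mem_insert, Finset.mem_image, mem_indepSubsets,
    isIndepSet_coe_iff]
  constructor
  · rintro ⟨⟨hIS, hI⟩, rfl⟩
    by_cases hvI : v ∈ I
    · left
      ext z
      simp only [Finset.mem_insert, Finset.mem_sdiff, Finset.mem_filter]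
      have := hI v hvI z
      by_cases hzv : z = v
      · simp [hzv, hvI]
      · simp only [hzv, false_or]
        tauto
    · right
      refine ⟨I ∩ S.filter (G.Adj v), ⟨?_, ?_⟩, ?_⟩
      · intro u hu
        rw [Finset.mem_inter] at hu
        refine Finset.mem_filter.2 ⟨hu.2, fun z hz => hI u hu.1 z (Finset.mem_sdiff.1 hz).1⟩
      · intro a ha b hb
        exact hI a (Finset.mem_inter.1 ha).1 b (Finset.mem_inter.1 hb).1
      · ext z
        simp only [Finset.mem_union, Finset.mem_insert, Finset.mem_sdiff, Finset.mem_inter]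
        have : z ∈ I → z ≠ v := fun h h' => hvI (h' ▸ h)
        tauto
  · rintro (rfl | ⟨J, ⟨hJX, hJ⟩, rfl⟩)
    · refine ⟨⟨Finset.insert_subset hv hTS, ?_⟩, ?_⟩
      · intro a ha b hb hab
        rcases Finset.mem_insert.1 ha with rfl | ha' <;>
          rcases Finset.mem_insert.1 hb with rfl | hb'
        · exact hab.ne rfl
        · exact (hTv' b hb').2 hab
        · exact (hTv' a ha').2 hab.symm
        · exact hTi a ha' b hb' hab
      · ext z
        have := fun h : z ∈ T => Finset.disjoint_left.1 hTv h
        simp only [Finset.mem_sdiff, Finset.mem_insert] at this ⊢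
        tauto
    · have hJ' : ∀ u ∈ J, u ∈ S.filter (G.Adj v) ∧ ∀ z ∈ T, ¬ G.Adj u z := fun u hu =>
        Finset.mem_filter.1 (hJX hu)
      refine ⟨⟨Finset.union_subset hTS fun u hu => (Finset.mem_filter.1 (hJ' u hu).1).1, ?_⟩, ?_⟩
      · intro a ha b hb hab
        rcases Finset.mem_union.1 ha with ha | ha <;> rcases Finset.mem_union.1 hb with hb | hb
        · exact hTi a ha b hb hab
        · exact (hJ' b hb).2 a ha hab.symm
        · exact (hJ' a ha).2 b hb hab
        · exact hJ a ha b hb hab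
      · ext z
        have := fun h : z ∈ T => Finset.disjoint_left.1 hTv h
        have h2 := hJ' z
        simp only [Finset.mem_sdiff, Finset.mem_insert, Finset.mem_union] at this ⊢
        tauto

-- Condition on the trace `T` of `I` outside the closed neighbourhood of `v`: what remains is either
-- `v` alone or an independent set of the neighbours not blocked by `T`. Then `local_occupancy`
-- applies to each fibre.
open Classical in
lemma occupancy_at_vertex {l D Δ K : ℝ} (hl : 0 ≤ l) (hl1 : l ≤ 1) (hD : l * D ≤ 1 / 2)
    (hK : 0 ≤ K) (hΔ : Real.exp (10 * K) ≤ Δ * l) {S : Finset V} {v : V} (hv : v ∈ S)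
    (hcodeg : ∀ u ∈ S.filter (G.Adj v),
      (((S.filter (G.Adj v)).filter (G.Adj u)).card : ℝ) ≤ D) :
    K * G.hardCore l S ≤ ∑ I ∈ G.indepSubsets S,
      l ^ I.card * ((if v ∈ I then Δ else 0) + (I ∩ S.filter (G.Adj v)).card) := by
  set N := S.filter (G.Adj v) with hN
  have hmaps : ∀ I ∈ G.indepSubsets S,
      I \ insert v N ∈ (G.indepSubsets S).image (· \ insert v N) :=
    fun I hI => Finset.mem_image_of_mem _ hI
  rw [hardCore, ← Finset.sum_fiberwise_of_maps_to hmaps, Finset.mul_sum,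
    ← Finset.sum_fiberwise_of_maps_to hmaps]
  refine Finset.sum_le_sum fun T hT => ?_
  obtain ⟨I₀, hI₀, rfl⟩ := Finset.mem_image.1 hT
  rw [mem_indepSubsets] at hI₀
  set T := I₀ \ insert v N
  have hTv : Disjoint T (insert v N) := Finset.sdiff_disjoint
  have hvN : v ∉ N := by simp [hN]
  have hvT : v ∉ T := fun h => Finset.disjoint_left.1 hTv h (Finset.mem_insert_self _ _)
  have hTi : G.IsIndepSet (T : Set V) :=
    hI₀.2.mono (by exact_mod_cast Finset.sdiff_subset)
  rw [indepSubsets_fiber hv (Finset.sdiff_subset.trans hI₀.1) hTi hTv]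
  set X := N.filter fun u => ∀ z ∈ T, ¬ G.Adj u z with hX
  have hXN : X ⊆ N := Finset.filter_subset _ _
  have hTN : Disjoint T N := hTv.mono_right (Finset.subset_insert _ _)
  have hJ : ∀ J ∈ G.indepSubsets X, J ⊆ N := fun J hJ => (mem_indepSubsets.1 hJ).1.trans hXN
  have hinj : Set.InjOn (T ∪ ·) (G.indepSubsets X : Set (Finset V)) := by
    intro J₁ h₁ J₂ h₂ h
    have d₁ : Disjoint T J₁ := hTN.mono_right (hJ _ h₁)
    have d₂ : Disjoint T J₂ := hTN.mono_right (hJ _ h₂)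
    rw [← Finset.union_sdiff_cancel_left d₁, ← Finset.union_sdiff_cancel_left d₂]
    exact congrArg (· \ T) h
  have hnot : insert v T ∉ (G.indepSubsets X).image (T ∪ ·) := by
    intro h
    obtain ⟨J, h1, h2⟩ := Finset.mem_image.1 h
    have : v ∈ T ∪ J := by
      rw [h2]; exact Finset.mem_insert_self _ _
    rcases Finset.mem_union.1 this with h | h
    · exact hvT h
    · exact hvN (hJ J h1 h)
  rw [Finset.sum_insert hnot, Finset.sum_insert hnot, Finset.sum_image hinj,
    Finset.sum_image hinj]
  have e1 : ∑ J ∈ G.indepSubsets X, l ^ (T ∪ J).card = l ^ T.card * G.hardCore l X := by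
    rw [hardCore, Finset.mul_sum]
    refine Finset.sum_congr rfl fun J h => ?_
    rw [Finset.card_union_of_disjoint (hTN.mono_right (hJ _ h)), pow_add]
  have e2 : ∑ J ∈ G.indepSubsets X, l ^ (T ∪ J).card *
      ((if v ∈ T ∪ J then Δ else 0) + ((T ∪ J) ∩ N).card) =
      l ^ T.card * ∑ J ∈ G.indepSubsets X, l ^ J.card * J.card := by
    rw [Finset.mul_sum]
    refine Finset.sum_congr rfl fun J h => ?_
    have hv' : v ∉ T ∪ J := fun h' => (Finset.mem_union.1 h').elim hvT fun h' => hvN (hJ J h h')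
    rw [Finset.card_union_of_disjoint (hTN.mono_right (hJ _ h)), pow_add, if_neg hv',
      Finset.union_inter_distrib_right, Finset.disjoint_iff_inter_eq_empty.1 hTN,
      Finset.inter_eq_left.2 (hJ J h), Finset.empty_union]
    ring
  have e3 : (insert v T ∩ N).card = 0 := by
    rw [Finset.insert_inter_of_notMem hvN, Finset.disjoint_iff_inter_eq_empty.1 hTN,
      Finset.card_empty]
  rw [e1, e2, e3, Finset.card_insert_of_notMem hvT, if_pos (Finset.mem_insert_self _ _)]
  have key := local_occupancy hl hl1 hD hK hΔ (G := G) (X := X) (fun u hu => by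
    refine le_trans ?_ (hcodeg u (hXN hu))
    exact_mod_cast Finset.card_le_card (Finset.filter_subset_filter _ hXN))
  have := mul_le_mul_of_nonneg_left key (pow_nonneg hl T.card)
  rw [pow_succ]
  push_cast
  linarith

open Classical in
/-- A graph of maximum degree `Δ` in which adjacent vertices have few common neighbours has a
large independent set. -/
theorem card_mul_le_of_codegree_le {D Δ K t : ℝ} (hD : 1 ≤ D) (hK : 0 ≤ K)
    (hΔ : 2 * D * Real.exp (10 * K) ≤ Δ) {S : Finset V}
    (hdeg : ∀ v ∈ S, ((S.filter (G.Adj v)).card : ℝ) ≤ Δ)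
    (hcodeg : ∀ v ∈ S, ∀ u ∈ S.filter (G.Adj v),
      (((S.filter (G.Adj v)).filter (G.Adj u)).card : ℝ) ≤ D)
    (ht : ∀ I ⊆ S, G.IsIndepSet (I : Set V) → (I.card : ℝ) ≤ t) :
    S.card * K ≤ 2 * Δ * t := by
  set l : ℝ := 1 / (2 * D) with hldef
  have hl : 0 ≤ l := by positivity
  have hlD : l * D = 1 / 2 := by rw [hldef]; field_simp
  have hl1 : l ≤ 1 := by nlinarith
  have hΔ' : Real.exp (10 * K) ≤ Δ * l := by
    rw [hldef, mul_one_div, le_div_iff₀ (by positivity)]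
    linarith
  have hΔ0 : 0 ≤ Δ := le_trans (by positivity) hΔ
  have hZ := one_le_hardCore (G := G) hl S
  have hsum : ∑ v ∈ S, K * G.hardCore l S ≤ ∑ v ∈ S, ∑ I ∈ G.indepSubsets S,
      l ^ I.card * ((if v ∈ I then Δ else 0) + (I ∩ S.filter (G.Adj v)).card) :=
    Finset.sum_le_sum fun v hv =>
      occupancy_at_vertex hl hl1 hlD.le hK hΔ' hv (hcodeg v hv)
  -- Exchange the sums: for fixed `I`, both the `Δ` terms and the edges leaving `I` total at most
  -- `|I| * Δ`.
  rw [Finset.sum_comm, Finset.sum_const, nsmul_eq_mul] at hsum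
  have hI : ∀ I ∈ G.indepSubsets S, ∑ v ∈ S,
      l ^ I.card * ((if v ∈ I then Δ else 0) + ((I ∩ S.filter (G.Adj v)).card : ℝ)) ≤
      l ^ I.card * (2 * Δ * t) := by
    intro I hI
    rw [mem_indepSubsets] at hI
    rw [← Finset.mul_sum]
    refine mul_le_mul_of_nonneg_left ?_ (pow_nonneg hl _)
    have h1 : ∑ v ∈ S, (if v ∈ I then Δ else 0) = I.card * Δ := by
      rw [← Finset.sum_filter, Finset.filter_mem_eq_inter, Finset.inter_eq_right.2 hI.1]
      simp
    have h2 : ∑ v ∈ S, ((I ∩ S.filter (G.Adj v)).card : ℝ) =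
        ∑ u ∈ I, ((S.filter (G.Adj u)).card : ℝ) := by
      have h3 : ∀ v ∈ S, ((I ∩ S.filter (G.Adj v)).card : ℝ) =
          ∑ u ∈ I, if G.Adj v u then (1 : ℝ) else 0 := by
        intro v _
        rw [← Finset.sum_filter, Finset.sum_const, nsmul_eq_mul, mul_one]
        congr 2
        ext u
        simp only [Finset.mem_inter, Finset.mem_filter]
        exact ⟨fun h => ⟨h.1, h.2.2⟩, fun h => ⟨h.1, hI.1 h.1, h.2⟩⟩
      rw [Finset.sum_congr rfl h3, Finset.sum_comm]
      refine Finset.sum_congr rfl fun u _ => ?_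
      rw [← Finset.sum_filter, Finset.sum_const, nsmul_eq_mul, mul_one]
      simp only [G.adj_comm]
    have h4 : ∑ u ∈ I, ((S.filter (G.Adj u)).card : ℝ) ≤ I.card * Δ := by
      have := Finset.sum_le_sum fun u (hu : u ∈ I) => hdeg u (hI.1 hu)
      simpa using this
    have h5 : I.card * Δ ≤ t * Δ := mul_le_mul_of_nonneg_right (ht I hI.1 hI.2) hΔ0
    rw [Finset.sum_add_distrib, h1, h2]
    linarith
  have h := hsum.trans (Finset.sum_le_sum hI)
  rw [← Finset.sum_mul] at h
  change _ ≤ G.hardCore l S * _ at h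
  have h' : G.hardCore l S * (S.card * K) ≤ G.hardCore l S * (2 * Δ * t) := by linarith
  exact le_of_mul_le_mul_left h' (by linarith)

/-! ### Ramsey bounds -/

open Classical in
lemma CliqueFreeOn.filter_adj {S : Finset V} {n : ℕ} (h : G.CliqueFreeOn (S : Set V) (n + 1))
    {v : V} (hv : v ∈ S) : G.CliqueFreeOn ((S.filter (G.Adj v) : Finset V) : Set V) n := by
  have := h.of_succ G (a := v) (by exact_mod_cast hv)
  refine CliqueFreeOn.subset G ?_ this
  intro u hu
  simpa using hu

/-- The Erdős–Szekeres bound, up to constants. -/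
lemma card_le_two_mul_pow (s : ℕ) {t : ℝ} (ht1 : 1 ≤ t) {S : Finset V}
    (hS : G.CliqueFreeOn (S : Set V) (s + 1))
    (ht : ∀ I ⊆ S, G.IsIndepSet (I : Set V) → (I.card : ℝ) ≤ t) :
    (S.card : ℝ) ≤ (2 * t) ^ s := by
  classical
  induction s generalizing S with
  | zero =>
    have : S = ∅ := by
      rw [Finset.eq_empty_iff_forall_notMem]
      intro v hv
      exact hS (t := {v}) (by simpa using hv) (by simp)
    simp [this]
  | succ s ih =>
    obtain ⟨I, hI, hmax⟩ := Finset.exists_max_image (G.indepSubsets S) Finset.card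
      ⟨∅, empty_mem_indepSubsets S⟩
    rw [mem_indepSubsets] at hI
    -- A maximum independent set dominates `S`, and each neighbourhood has a smaller clique number.
    have hcover : S ⊆ I ∪ I.biUnion fun v => S.filter (G.Adj v) := by
      intro u hu
      by_contra hcon
      simp only [Finset.mem_union, Finset.mem_biUnion, Finset.mem_filter, not_or, not_exists,
        not_and] at hcon
      have hi : G.IsIndepSet ((insert u I : Finset V) : Set V) := by
        have h0 := isIndepSet_coe_iff.1 hI.2
        rw [isIndepSet_coe_iff]
        intro a ha b hb hab
        rcases Finset.mem_insert.1 ha with rfl | ha' <;>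
          rcases Finset.mem_insert.1 hb with rfl | hb'
        · exact hab.ne rfl
        · exact hcon.2 b hb' hu hab.symm
        · exact hcon.2 a ha' hu hab
        · exact h0 a ha' b hb' hab
      have := hmax _ (mem_indepSubsets.2 ⟨Finset.insert_subset hu hI.1, hi⟩)
      rw [Finset.card_insert_of_notMem hcon.1] at this
      omega
    have h1 : (S.card : ℝ) ≤ I.card + ∑ v ∈ I, ((S.filter (G.Adj v)).card : ℝ) := by
      have := (Finset.card_le_card hcover).trans ((Finset.card_union_le _ _).trans
        (Nat.add_le_add_left Finset.card_biUnion_le _))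
      exact_mod_cast this
    have h2 : ∑ v ∈ I, ((S.filter (G.Adj v)).card : ℝ) ≤ ∑ v ∈ I, (2 * t) ^ s :=
      Finset.sum_le_sum fun v hv => ih (hS.filter_adj (hI.1 hv)) fun J hJ =>
        ht J (hJ.trans (Finset.filter_subset _ _))
    rw [Finset.sum_const, nsmul_eq_mul] at h2
    have h3 := ht I hI.1 hI.2
    have h4 : (1 : ℝ) ≤ (2 * t) ^ s := one_le_pow₀ (by linarith)
    have h5 : (I.card : ℝ) * (2 * t) ^ s ≤ t * (2 * t) ^ s := by gcongr
    have h6 : t * 1 ≤ t * (2 * t) ^ s := by gcongr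
    rw [pow_succ]
    linarith

/-- Compare `exp` at `log t / 2` with the `k`-th term of its series. -/
lemma log_pow_le_mul_sqrt (k : ℕ) {t : ℝ} (ht : 1 ≤ t) :
    Real.log t ^ k ≤ 2 ^ k * k.factorial * √t := by
  have h0 : 0 ≤ Real.log t := Real.log_nonneg ht
  have h := Real.pow_div_factorial_le_exp (Real.log t / 2) (by linarith) k
  have h1 : Real.exp (Real.log t / 2) = √t := by
    rw [Real.exp_half, Real.exp_log (by linarith)]
  rw [h1, div_le_iff₀ (by positivity), div_pow, div_le_iff₀ (by positivity)] at h
  linarith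

/-- The Ajtai–Komlós–Szemerédi bound for off-diagonal Ramsey numbers. -/
theorem exists_card_le_pow_div_log_pow (k : ℕ) :
    ∃ C : ℝ, 0 < C ∧ ∀ (V : Type*) (G : SimpleGraph V) (S : Finset V) (t : ℝ), 1 < t →
      G.CliqueFreeOn (S : Set V) (k + 2) →
      (∀ I ⊆ S, G.IsIndepSet (I : Set V) → (I.card : ℝ) ≤ t) →
      (S.card : ℝ) ≤ C * t ^ (k + 1) / Real.log t ^ k := by
  classical
  induction k with
  | zero =>
    refine ⟨2, two_pos, fun V G S t ht hS hI => ?_⟩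
    have := card_le_two_mul_pow 1 ht.le hS hI
    simpa using this
  | succ k ih =>
    obtain ⟨C, hC, h⟩ := ih
    -- `C` serves the inductive degree bound; the second summand forces `2 * D * √t ≤ Δ`.
    set B : ℝ := C + 2 ^ (k + 1) * (2 ^ k * k.factorial) with hB
    have hBpos : 0 < B := by positivity
    refine ⟨40 * B, by positivity, fun V G S t ht hS hI => ?_⟩
    have ht0 : 0 < t := by linarith
    have hL : 0 < Real.log t := Real.log_pos ht
    -- `K = log t / 20` makes `exp (10 * K) = √t`, which fits in the gap between `D` and `Δ`.
    have key := card_mul_le_of_codegree_le (G := G) (D := (2 * t) ^ k)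
      (Δ := B * t ^ (k + 1) / Real.log t ^ k) (K := Real.log t / 20) (t := t) (S := S)
      (one_le_pow₀ (by linarith)) (by positivity) ?_ ?_ ?_ hI
    · rw [le_div_iff₀ (by positivity), pow_succ (Real.log t)]
      have e : 2 * (B * t ^ (k + 1) / Real.log t ^ k) * t * 20 * Real.log t ^ k =
          40 * B * t ^ (k + 1 + 1) := by
        field_simp
        ring
      rw [← e]
      have := mul_le_mul_of_nonneg_right key (by positivity : 0 ≤ 20 * Real.log t ^ k)
      linarith
    · have e : Real.exp (10 * (Real.log t / 20)) = √t := by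
        rw [show 10 * (Real.log t / 20) = Real.log t / 2 by ring, Real.exp_half,
          Real.exp_log ht0]
      rw [e, le_div_iff₀ (by positivity)]
      have h1 := log_pow_le_mul_sqrt k ht.le
      calc 2 * (2 * t) ^ k * √t * Real.log t ^ k
          ≤ 2 * (2 * t) ^ k * √t * (2 ^ k * k.factorial * √t) := by gcongr
        _ = 2 ^ (k + 1) * (2 ^ k * k.factorial) * t ^ k * (√t * √t) := by
            rw [mul_pow]; ring
        _ = 2 ^ (k + 1) * (2 ^ k * k.factorial) * t ^ (k + 1) := by
            rw [Real.mul_self_sqrt ht0.le]; ring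
        _ ≤ B * t ^ (k + 1) := by gcongr; linarith
    · intro v hv
      refine (h V G _ t ht (hS.filter_adj hv) fun J hJ =>
        hI J (hJ.trans (Finset.filter_subset _ _))).trans ?_
      gcongr
      rw [hB]
      have : (0 : ℝ) ≤ 2 ^ (k + 1) * (2 ^ k * k.factorial) := by positivity
      linarith
    · intro v hv u hu
      exact card_le_two_mul_pow k ht.le ((hS.filter_adj hv).filter_adj hu) fun J hJ =>
        hI J (hJ.trans ((Finset.filter_subset _ _).trans (Finset.filter_subset _ _)))

/-! ### Greedy colouring and its supply of independent sets -/

/-- Greedy colouring by large independent sets. -/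
lemma exists_coloring_of_large_indep {q a β : ℝ} (hq : 0 < q) (ha : 0 < a) (hβ : 0 < β)
    (hβ1 : β ≤ 1) (S : Finset V)
    (h : ∀ T ⊆ S, q ≤ T.card → ∃ I ⊆ T, G.IsIndepSet (I : Set V) ∧
      a * (T.card : ℝ) ^ (1 - β) ≤ I.card) :
    ∃ (m : ℕ) (f : V → ℕ), (∀ v ∈ S, f v < m) ∧ (∀ u ∈ S, ∀ v ∈ S, G.Adj u v → f u ≠ f v) ∧
      (m : ℝ) ≤ q + (S.card : ℝ) ^ β / (β * a) := by
  classical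
  induction S using Finset.strongInduction with
  | H S ih =>
    by_cases hS : q ≤ S.card
    · obtain ⟨I, hIS, hI, hIc⟩ := h S subset_rfl hS
      have hS0 : (0 : ℝ) < S.card := hq.trans_le hS
      have hI0 : (0 : ℝ) < I.card := lt_of_lt_of_le (by positivity) hIc
      have hIne : I.Nonempty := Finset.card_pos.1 (by exact_mod_cast hI0)
      have hlt : S \ I ⊂ S := Finset.sdiff_ssubset hIS hIne
      obtain ⟨m, f, hfm, hf, hm⟩ := ih (S \ I) hlt fun T hT => h T (hT.trans hlt.subset)
      refine ⟨m + 1, fun v => if v ∈ I then m else f v, ?_, ?_, ?_⟩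
      · intro v hv
        dsimp only
        split_ifs with hvI
        · exact Nat.lt_succ_self m
        · exact (hfm v (Finset.mem_sdiff.2 ⟨hv, hvI⟩)).trans (Nat.lt_succ_self m)
      · intro u hu v hv huv
        dsimp only
        split_ifs with h1 h2 h2
        · exact absurd huv (isIndepSet_coe_iff.1 hI u h1 v h2)
        · exact (hfm v (Finset.mem_sdiff.2 ⟨hv, h2⟩)).ne'
        · exact (hfm u (Finset.mem_sdiff.2 ⟨hu, h1⟩)).ne
        · exact hf u (Finset.mem_sdiff.2 ⟨hu, h1⟩) v (Finset.mem_sdiff.2 ⟨hv, h2⟩) huv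
      · have hcard : ((S \ I).card : ℝ) = S.card - I.card := by
          rw [Finset.card_sdiff_of_subset hIS, Nat.cast_sub (Finset.card_le_card hIS)]
        have hle : (I.card : ℝ) ≤ S.card := by exact_mod_cast Finset.card_le_card hIS
        set s : ℝ := (S.card : ℝ)
        set i : ℝ := (I.card : ℝ)
        have hx : i / s ≤ 1 := (div_le_one hS0).2 hle
        -- Bernoulli's inequality: removing `I` lowers the potential `s ^ β` by at least `β * a`,
        -- which pays for one colour.
        have hbern := rpow_one_add_le_one_add_mul_self (s := -(i / s)) (by linarith) hβ.le hβ1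
        have e1 : (s - i) ^ β = s ^ β * (1 + -(i / s)) ^ β := by
          rw [← Real.mul_rpow hS0.le (by linarith)]
          congr 1
          field_simp
          ring
        have e2 : s ^ β * (i / s) * s ^ (1 - β) = i := by
          have : s ^ β * s ^ (1 - β) = s := by
            rw [← Real.rpow_add hS0]; simp
          calc s ^ β * (i / s) * s ^ (1 - β) = (s ^ β * s ^ (1 - β)) * (i / s) := by ring
            _ = i := by rw [this]; field_simp
        have e3 : a ≤ s ^ β * (i / s) := by
          refine le_of_mul_le_mul_right ?_ (Real.rpow_pos_of_pos hS0 (1 - β))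
          rwa [e2]
        have e4 : (s - i) ^ β ≤ s ^ β - β * a := by
          rw [e1]
          have h1 := mul_le_mul_of_nonneg_left hbern (Real.rpow_nonneg hS0.le β)
          have h2 := mul_le_mul_of_nonneg_left e3 hβ.le
          linarith
        rw [hcard] at hm
        have e5 : (s - i) ^ β / (β * a) ≤ s ^ β / (β * a) - 1 := by
          rw [div_le_iff₀ (by positivity), sub_mul, div_mul_cancel₀ _ (by positivity)]
          linarith
        push_cast
        linarith
    -- Fewer than `q` vertices remain, so each gets its own colour; the value `0` outside `S` is
    -- irrelevant.
    · obtain ⟨e⟩ : Nonempty (S ≃ Fin S.card) := ⟨S.equivFin⟩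
      refine ⟨S.card, fun v => if hv : v ∈ S then e ⟨v, hv⟩ else 0, ?_, ?_, ?_⟩
      · intro v hv
        simp [hv]
      · intro u hu v hv huv heq
        simp only [hu, hv, dif_pos] at heq
        have := e.injective (Fin.ext heq)
        exact huv.ne (by simpa using this)
      · have : 0 ≤ (S.card : ℝ) ^ β / (β * a) := by positivity
        push Not at hS
        linarith

/-- Clique-free sets of polynomial size contain large independent sets. -/
lemma exists_large_indep (k : ℕ) :
    ∃ c : ℝ, 0 < c ∧ ∃ N : ℕ, ∀ n : ℕ, N ≤ n →
      ∀ (V : Type*) (G : SimpleGraph V) (S : Finset V), G.CliqueFreeOn (S : Set V) (k + 3) →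
        (n : ℝ) ^ (1 / 4 : ℝ) ≤ S.card → ∃ I ⊆ S, G.IsIndepSet (I : Set V) ∧
          (c * Real.log n ^ (k + 1)) ^ (1 / ((k : ℝ) + 2)) * (S.card : ℝ) ^ (1 / ((k : ℝ) + 2)) ≤
            I.card := by
  obtain ⟨C, hC, h⟩ := exists_card_le_pow_div_log_pow (k + 1)
  -- Chosen so that `t ^ (k + 2) ≥ n ^ (1 / 8)` gives `log t ≥ δ * log n`.
  set δ : ℝ := 1 / (8 * (k + 2)) with hδ
  have hδ0 : 0 < δ := by positivity
  -- The factor `2` makes the Ramsey bound read `s ≤ s / 2`, a contradiction.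
  set c : ℝ := δ ^ (k + 1) / (2 * C) with hc
  have hc0 : 0 < c := by positivity
  have hev : ∀ᶠ n : ℕ in Filter.atTop, 1 / c ≤ (n : ℝ) ^ (1 / 8 : ℝ) :=
    ((tendsto_rpow_atTop (by norm_num)).comp
      tendsto_natCast_atTop_atTop).eventually_ge_atTop (1 / c)
  obtain ⟨N, hN⟩ := Filter.eventually_atTop.1 hev
  refine ⟨c, hc0, max N 3, fun n hn V G S hS hcard => ?_⟩
  have hnN := hN n (le_of_max_le_left hn)
  have hn3 : (3 : ℝ) ≤ n := by exact_mod_cast le_of_max_le_right hn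
  have hn0 : (0 : ℝ) < n := by linarith
  set L := Real.log n with hL
  have hL1 : 1 ≤ L := by
    rw [hL, Real.le_log_iff_exp_le hn0]
    linarith [Real.exp_one_lt_d9]
  have hS0 : (0 : ℝ) < S.card := (Real.rpow_pos_of_pos hn0 _).trans_le hcard
  set s : ℝ := (S.card : ℝ) with hs
  rw [← Real.mul_rpow (by positivity) hS0.le]
  set t : ℝ := (c * L ^ (k + 1) * s) ^ (1 / ((k : ℝ) + 2)) with ht
  have ht0 : 0 < t := by positivity
  have htpow : t ^ (k + 2) = c * L ^ (k + 1) * s := by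
    rw [ht, ← Real.rpow_natCast, ← Real.rpow_mul (by positivity)]
    push_cast
    rw [one_div_mul_cancel (by positivity), Real.rpow_one]
  -- Half of the exponent `1 / 4` is spent on absorbing the constant `c`.
  have hlarge : (n : ℝ) ^ (1 / 8 : ℝ) ≤ t ^ (k + 2) := by
    have e : (n : ℝ) ^ (1 / 4 : ℝ) = (n : ℝ) ^ (1 / 8 : ℝ) * (n : ℝ) ^ (1 / 8 : ℝ) := by
      rw [← Real.rpow_add hn0]; norm_num
    have h1 : 1 ≤ c * (n : ℝ) ^ (1 / 8 : ℝ) := by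
      rw [div_le_iff₀ hc0] at hnN; linarith
    have h2 : (1 : ℝ) ≤ L ^ (k + 1) := one_le_pow₀ hL1
    have hp : 0 < (n : ℝ) ^ (1 / 8 : ℝ) := Real.rpow_pos_of_pos hn0 _
    calc (n : ℝ) ^ (1 / 8 : ℝ) = 1 * 1 * (n : ℝ) ^ (1 / 8 : ℝ) := by ring
      _ ≤ (c * (n : ℝ) ^ (1 / 8 : ℝ)) * L ^ (k + 1) * (n : ℝ) ^ (1 / 8 : ℝ) := by gcongr
      _ = c * L ^ (k + 1) * (n : ℝ) ^ (1 / 4 : ℝ) := by rw [e]; ring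
      _ ≤ _ := by rw [htpow]; gcongr
  have hlog : δ * L ≤ Real.log t := by
    have := Real.log_le_log (Real.rpow_pos_of_pos hn0 _) hlarge
    rw [Real.log_rpow hn0, Real.log_pow] at this
    push_cast at this
    rw [hδ, div_mul_eq_mul_div, div_le_iff₀ (by positivity)]
    linarith
  have hδL : 0 < δ * L := by positivity
  have ht1 : 1 < t := (Real.log_pos_iff ht0.le).1 (hδL.trans_le hlog)
  by_contra hcon
  push Not at hcon
  have hb := h V G S t ht1 hS fun I hIS hI => (hcon I hIS hI).le
  have hpow : (δ * L) ^ (k + 1) ≤ Real.log t ^ (k + 1) := by gcongr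
  have hnum : 0 ≤ C * t ^ (k + 1 + 1) := by positivity
  have hb2 : s ≤ C * t ^ (k + 1 + 1) / (δ * L) ^ (k + 1) :=
    hb.trans (div_le_div_of_nonneg_left hnum (by positivity) hpow)
  have : C * t ^ (k + 1 + 1) / (δ * L) ^ (k + 1) = s / 2 := by
    rw [show k + 1 + 1 = k + 2 by ring, htpow, hc, mul_pow]
    field_simp
  linarith

/-! ### The chromatic bound -/

lemma log_le_sqrt {x : ℝ} (hx : 0 < x) : Real.log x ≤ √x := by
  have hy : 0 < √x := Real.sqrt_pos.2 hx
  have h1 := Real.log_le_sub_one_of_pos (x := √x / 2) (by positivity)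
  rw [Real.log_div hy.ne' two_ne_zero, Real.log_sqrt hx.le] at h1
  have h2 := Real.log_two_lt_d9
  linarith

end SimpleGraph

theorem mainTheorem6 (r : ℕ) (hr : 3 ≤ r) :
    ∃ C : ℝ, 0 < C ∧ ∃ N : ℕ, ∀ n : ℕ, N ≤ n →
      ∀ (V : Type*) [Fintype V] (G : SimpleGraph V),
        Fintype.card V = n → G.CliqueFree r →
          ∃ k : ℕ, G.chromaticNumber = (k : ℕ∞) ∧
            (k : ℝ) ≤ C * ((n : ℝ) / Real.log (n : ℝ)) ^ (((r : ℝ) - 2) / ((r : ℝ) - 1)) := by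
  obtain ⟨k, rfl⟩ : ∃ k, r = k + 3 := ⟨r - 3, by omega⟩
  obtain ⟨c, hc, N, hN⟩ := SimpleGraph.exists_large_indep k
  set γ : ℝ := 1 / ((k : ℝ) + 2) with hγ
  have hk : (0 : ℝ) ≤ k := Nat.cast_nonneg k
  have hβ : (((k + 3 : ℕ) : ℝ) - 2) / (((k + 3 : ℕ) : ℝ) - 1) = 1 - γ := by
    push_cast
    rw [hγ, div_eq_iff (by linarith)]
    field_simp
    ring
  have hγ2 : γ ≤ 1 / 2 := by
    rw [hγ]
    exact one_div_le_one_div_of_le two_pos (by linarith)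
  have hγ0 : 0 < γ := by positivity
  rw [hβ]
  have hcγ : 0 < c ^ γ := Real.rpow_pos_of_pos hc γ
  have hβ0 : 0 < 1 - γ := by linarith
  refine ⟨1 + 1 / ((1 - γ) * c ^ γ), by positivity, max N 3, fun n hn V _ G hV hG => ?_⟩
  have hn3 : (3 : ℝ) ≤ n := by exact_mod_cast le_of_max_le_right hn
  have hn0 : (0 : ℝ) < n := by linarith
  set L := Real.log n with hL
  have hL0 : 0 < L := Real.log_pos (by linarith)
  -- `(k + 1) * γ = 1 - γ`, so `n` and `L` end up with the same exponent in the greedy bound.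
  have hLγ : (c * L ^ (k + 1)) ^ γ = c ^ γ * L ^ (1 - γ) := by
    rw [Real.mul_rpow hc.le (by positivity), ← Real.rpow_natCast, ← Real.rpow_mul hL0.le]
    congr 2
    rw [hγ]
    push_cast
    field_simp
    ring
  obtain ⟨m, f, hfm, hf, hm⟩ := SimpleGraph.exists_coloring_of_large_indep (G := G)
    (q := (n : ℝ) ^ (1 / 4 : ℝ)) (a := (c * L ^ (k + 1)) ^ γ) (β := 1 - γ)
    (by positivity) (by positivity) hβ0 (by linarith) Finset.univ (fun T _ hT => by
      rw [sub_sub_cancel]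
      exact hN n (le_of_max_le_left hn) V G T hG.cliqueFreeOn hT)
  have hcol : G.Colorable m :=
    ⟨SimpleGraph.Coloring.mk (fun v => (⟨f v, hfm v (Finset.mem_univ v)⟩ : Fin m))
      fun {u v} huv heq => hf u (Finset.mem_univ u) v (Finset.mem_univ v) huv
        (congrArg Fin.val heq)⟩
  have hle : G.chromaticNumber ≤ m := hcol.chromaticNumber_le
  obtain ⟨χ, hχ⟩ := ENat.ne_top_iff_exists.1 (ne_top_of_le_ne_top (ENat.natCast_ne_top m) hle)
  refine ⟨χ, hχ.symm, ?_⟩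
  have hχm : (χ : ℝ) ≤ m := by
    rw [← hχ] at hle
    exact_mod_cast hle
  refine (hχm.trans hm).trans ?_
  rw [Finset.card_univ, hV, hLγ]
  have e1 : (n : ℝ) ^ (1 - γ) / ((1 - γ) * (c ^ γ * L ^ (1 - γ))) =
      1 / ((1 - γ) * c ^ γ) * ((n : ℝ) / L) ^ (1 - γ) := by
    rw [Real.div_rpow hn0.le hL0.le]
    have : L ^ (1 - γ) ≠ 0 := (Real.rpow_pos_of_pos hL0 _).ne'
    field_simp
  -- The uncoloured remainder is negligible because `1 - γ ≥ 1 / 2` and `n / L ≥ √n`.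
  have e2 : (n : ℝ) ^ (1 / 4 : ℝ) ≤ ((n : ℝ) / L) ^ (1 - γ) := by
    have h1 : √(n : ℝ) ≤ n / L := by
      rw [le_div_iff₀ hL0]
      calc √(n : ℝ) * L ≤ √(n : ℝ) * √(n : ℝ) := by
            gcongr
            exact SimpleGraph.log_le_sqrt hn0
        _ = n := Real.mul_self_sqrt hn0.le
    have h2 : 1 ≤ √(n : ℝ) := Real.one_le_sqrt.2 (by linarith)
    calc (n : ℝ) ^ (1 / 4 : ℝ) = √(n : ℝ) ^ (1 / 2 : ℝ) := by
          rw [Real.sqrt_eq_rpow, ← Real.rpow_mul hn0.le]; norm_num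
      _ ≤ √(n : ℝ) ^ (1 - γ) := Real.rpow_le_rpow_of_exponent_le h2 (by linarith)
      _ ≤ _ := Real.rpow_le_rpow (by positivity) h1 hβ0.le
  rw [e1, add_mul, one_mul]
  linarith
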